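/- Let $\mathfrak n=(0,0,0,12,23,14-35)$ be the 6-dimensional real nilpotent Lie algebra whose dual has a basis $\alpha^1,\dots,\alpha^6$ with $d\alpha^1=d\alpha^2=d\alpha^3=0$, $d\alpha^4=\alpha^1\wedge\alpha^2$, $d\alpha^5=\alpha^2\wedge\alpha^3$, $d\alpha^6=\alpha^1\wedge\alpha^4-\alpha^3\wedge\alpha^5$. Let $G$ be a simply connected Lie group with Lie algebra isomorphic to $\mathfrak n$, let $\Gamma\subset G$ be a discrete subgroup with compact quotient, and let $N=\Gamma\backslash G$. Let $J$ be any invariant complex structure on $N$, i.e. one induced by an endomorphism $J$ of $\mathfrak n$ with $J^2=-\mathrm{Id}$ and $[JX,JY]=J[JX,Y]+J[X,JY]+[X,Y]$. Then there are an SU(3)-structure $(J,F,\Psi)$ on the compact complex manifold $(N,J)$, a smooth dilaton function $\phi$ on $N$, a smooth linear connection $A$ on the tangent bundle $TN$, and a constant $\alpha'>0$ which solve the heterotic supersymmetry equations with constant $\phi$, non-zero flux and non-flat $A$. Explicitly: there are a smooth $J$-Hermitian metric $g$ on $N$ and a smooth complex 3-form $\Psi$ such that near each point there is an orthonormal coframe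 $e^1,\dots,e^6$ with $Je^1=-e^2$, $Je^3=-e^4$, $Je^5=-e^6$ (where $(J\beta)(X)=-\beta(JX)$ on 1-forms) and $\Psi=(e^1+ie^2)\wedge(e^3+ie^4)\wedge(e^5+ie^6)$. Write $F(X,Y)=g(X,JY)$, let $T(X,Y,Z)=-dF(JX,JY,JZ)$ be the flux, $\theta=-\tfrac12 J\delta F$ the Lee form, $\nabla^g$ the Levi-Civita connection, $\nabla^+$ the Bismut connection, given by $g(\nabla^+_XY,Z)=g(\nabla^g_XY,Z)+\tfrac12T(X,Y,Z)$, and $\nabla^c$ the Chern connection, given by $g(\nabla^c_XY,Z)=g(\nabla^g_XY,Z)+\tfrac12dF(JX,Y,Z)$. For a metric connection with curvature forms $\Omega^i_j$ in an orthonormal frame, let $p_1=\frac1{8\pi^2}\sum_{i<j}\Omega^i_j\wedge\Omega^i_j$. Then: 1. $d\Psi=0$, so $\Psi$ is a holomorphic $(3,0)$-form; 2. (gravitino) the holonomy of $\nabla^+$ is contained in the group SU(3) of the structure; 3. (dilatino) $\theta=2\,d\phi$, and $\phi$ is constant; 4. (gaugino) $A$ is an SU(3)-instanton, i.e. $g$,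 $J$ and $\Psi$ are $A$-parallel and the curvature 2-form $\Omega^A$ is of type $(1,1)$ with $\Omega^A(e_1,e_2)+\Omega^A(e_3,e_4)+\Omega^A(e_5,e_6)=0$, where $e_1,\dots,e_6$ is the frame dual to $e^1,\dots,e^6$; moreover $\Omega^A\neq0$; 5. (anomaly cancellation) $dT=2\pi^2\alpha'\,\bigl(p_1(\nabla^c)-p_1(A)\bigr)$; 6. $T\neq0$. -/

import Mathlib

open scoped Manifold ContDiff

noncomputable section

namespace Heterotic

/-! ### Lie algebras, complex structures -/

section LieAlgebra

variable {L : Type*} [AddCommGroup L] [Module ℝ L] [Bracket L L]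

/-- `L` is isomorphic to the Lie algebra `(0,0,0,12,23,14-35)`: there is a basis with dual basis
`α¹,…,α⁶` (indexed here by `0,…,5`) such that `dα¹ = dα² = dα³ = 0`, `dα⁴ = α¹∧α²`,
`dα⁵ = α²∧α³`, `dα⁶ = α¹∧α⁴ - α³∧α⁵`, where `dα(X,Y) = -α([X,Y])`. -/
def IsAlgebraN (L : Type*) [AddCommGroup L] [Module ℝ L] [Bracket L L] : Prop :=
  ∃ b : Module.Basis (Fin 6) ℝ L,
    let d : Fin 6 → L → L → ℝ := fun k X Y => -(b.coord k ⁅X, Y⁆)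
    let w : Fin 6 → Fin 6 → L → L → ℝ := fun i j X Y =>
      b.coord i X * b.coord j Y - b.coord j X * b.coord i Y
    ∀ X Y : L,
      d 0 X Y = 0 ∧ d 1 X Y = 0 ∧ d 2 X Y = 0 ∧
      d 3 X Y = w 0 1 X Y ∧
      d 4 X Y = w 1 2 X Y ∧
      d 5 X Y = w 0 3 X Y - w 2 4 X Y

/-- Complex structures on a Lie algebra: `J² = -Id` and the Nijenhuis condition. -/
structure IsComplexStructure (J : L →ₗ[ℝ] L) : Prop where
  sq : ∀ X, J (J X) = -X
  nijenhuis : ∀ X Y, ⁅J X, J Y⁆ = J ⁅J X, Y⁆ + J ⁅X, J Y⁆ + ⁅X, Y⁆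

end LieAlgebra

/-! ### Tensor calculus on `Γ\G` in the left-invariant trivialisation

The left-invariant vector fields of `G` descend to `Γ\G` and trivialise its tangent bundle:
`T(Γ\G) = (Γ\G) × 𝔤`. So a smooth tensor field on `Γ\G` is the same as a smooth function on `G`,
invariant under left translation by `Γ`, with values in the tensors of `𝔤`; in the
definitions below a vector `X : 𝔤` stands for its left-invariant vector field. The fields are
*not* assumed to be `G`-invariant. -/

/-- The model space of six-dimensional manifolds. -/
abbrev E6 : Type := EuclideanSpace ℝ (Fin 6)

variable {G : Type*} [Group G] [TopologicalSpace G] [ChartedSpace E6 G]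

/-- The Lie algebra `𝔤` of `G`: the tangent space at the identity, with Mathlib's bracket. -/
abbrev Alg (G : Type*) [Group G] [TopologicalSpace G] [ChartedSpace E6 G] : Type :=
  GroupLieAlgebra (𝓡 6) G

/-- A smooth function on `Γ\G`: a smooth function on `G` invariant under left translation
by `Γ`. -/
def IsSmoothOnQuotient (Γ : Subgroup G) {V : Type*} [NormedAddCommGroup V] [NormedSpace ℝ V]
    (f : G → V) : Prop :=
  ContMDiff (𝓡 6) 𝓘(ℝ, V) ∞ f ∧ ∀ γ ∈ Γ, ∀ x, f (γ * x) = f x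

/-- The derivative `X · f` of a function along the left-invariant vector field of `X`. -/
def der {V : Type*} [NormedAddCommGroup V] [NormedSpace ℝ V]
    (X : Alg G) (f : G → V) (x : G) : V :=
  mfderiv (𝓡 6) 𝓘(ℝ, V) f x (mulInvariantVectorField (I := 𝓡 6) X x)

/-- The derivative `X · W` of the coefficients of a vector field `W : G → 𝔤`. -/
def derVec (X : Alg G) (W : G → Alg G) (x : G) : Alg G :=
  der (V := E6) X W x

/-- Exterior derivative of a 2-form. -/
def extDeriv2 {V : Type*} [NormedAddCommGroup V] [NormedSpace ℝ V]
    (η : G → Alg G → Alg G → V) (x : G) (X Y Z : Alg G) : V :=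
  der X (fun y => η y Y Z) x - der Y (fun y => η y X Z) x + der Z (fun y => η y X Y) x
    - η x ⁅X, Y⁆ Z + η x ⁅X, Z⁆ Y - η x ⁅Y, Z⁆ X

/-- Exterior derivative of a 3-form. -/
def extDeriv3 {V : Type*} [NormedAddCommGroup V] [NormedSpace ℝ V]
    (η : G → Alg G → Alg G → Alg G → V) (x : G) (X Y Z W : Alg G) : V :=
  der X (fun y => η y Y Z W) x - der Y (fun y => η y X Z W) x
    + der Z (fun y => η y X Y W) x - der W (fun y => η y X Y Z) x
    - η x ⁅X, Y⁆ Z W + η x ⁅X, Z⁆ Y W - η x ⁅X, W⁆ Y Z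
    - η x ⁅Y, Z⁆ X W + η x ⁅Y, W⁆ X Z - η x ⁅Z, W⁆ X Y

/-- The square `η ∧ η` of a real 2-form on a vector space. -/
def wedgeSq {L : Type*} (η : L → L → ℝ) (X Y Z W : L) : ℝ :=
  η X Y * η Z W - η X Z * η Y W + η X W * η Y Z
    + η Y Z * η X W - η Y W * η X Z + η Z W * η X Y

/-- A linear connection on the tangent bundle, given by the covariant derivatives
`∇_X Y` of left-invariant vector fields. -/
abbrev Conn (G : Type*) [Group G] [TopologicalSpace G] [ChartedSpace E6 G] : Type _ :=
  G → Alg G → Alg G → Alg G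

/-- The covariant derivative `∇_X W` of an arbitrary vector field `W`. -/
def covDeriv (D : Conn G) (X : Alg G) (W : G → Alg G) (x : G) : Alg G :=
  derVec X W x + D x X (W x)

/-- Curvature `R(X,Y)Z = ∇_X ∇_Y Z - ∇_Y ∇_X Z - ∇_[X,Y] Z`. -/
def curvature (D : Conn G) (x : G) (X Y Z : Alg G) : Alg G :=
  covDeriv D X (fun y => D y Y Z) x - covDeriv D Y (fun y => D y X Z) x - D x ⁅X, Y⁆ Z

/-- `L` is the parallel transport of the connection `D` around a `C¹` loop of `Γ\G` based
at `Γx`. Such a loop is the image of a path `c` in `G` from `x` to a point `γ x`, `γ ∈ Γ`; its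
velocity is `ξ`, and `t ↦ P t v` is the parallel vector field along it with initial value `v`.
(Piecewise `C¹` loops yield the same maps, since they can be reparametrised to be `C¹`.) -/
def IsHolonomy (Γ : Subgroup G) (D : Conn G) (x : G) (L : Alg G →ₗ[ℝ] Alg G) : Prop :=
  ∃ (c : ℝ → G) (ξ : ℝ → Alg G) (P : ℝ → Alg G → Alg G),
    ContMDiff 𝓘(ℝ, ℝ) (𝓡 6) 1 c ∧ c 0 = x ∧ (∃ γ ∈ Γ, c 1 = γ * x) ∧
    (∀ t ∈ Set.Icc (0 : ℝ) 1, mfderiv 𝓘(ℝ, ℝ) (𝓡 6) c t (1 : ℝ) =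
      mulInvariantVectorField (I := 𝓡 6) (ξ t) (c t)) ∧
    ∀ v : Alg G, P 0 v = v ∧ P 1 v = L v ∧
      ∀ t ∈ Set.Icc (0 : ℝ) 1,
        HasDerivWithinAt (F := E6) (fun s => P s v) (-(D (c t) (ξ t) (P t v)))
          (Set.Icc (0 : ℝ) 1) t

/-! ### SU(3)-structures -/

/-- The complex 1-form `e^j + i e^k` of a real basis. -/
def complexForm {L : Type*} [AddCommGroup L] [Module ℝ L] (b : Module.Basis (Fin 6) ℝ L)
    (j k : Fin 6) (X : L) : ℂ :=
  (b.coord j X : ℂ) + Complex.I * (b.coord k X : ℂ)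

/-- An SU(3)-structure `(J,F,Ψ)` on `(Γ\G, J)`: a smooth `J`-Hermitian metric `g` and a smooth
complex 3-form `Ψ` such that at each point there is an adapted basis `e₁,…,e₆` (indexed by
`0,…,5`): orthonormal, with `J e₂ = e₁`, `J e₄ = e₃`, `J e₆ = e₅` (that is, `Je¹ = -e²` and so on
for the dual basis, with `(Jα)(X) = -α(JX)`) and
`Ψ = (e¹ + i e²) ∧ (e³ + i e⁴) ∧ (e⁵ + i e⁶)`. The field `frame` picks one such basis at
every point, with no regularity; the notions defined below with its help do not depend on it. -/
structure SU3Structure (Γ : Subgroup G) (J : Alg G →ₗ[ℝ] Alg G) where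
  g : G → LinearMap.BilinForm ℝ (Alg G)
  Ψ : G → Alg G → Alg G → Alg G → ℂ
  frame : G → Module.Basis (Fin 6) ℝ (Alg G)
  g_smooth : ∀ X Y, IsSmoothOnQuotient Γ (fun x => g x X Y)
  g_symm : ∀ x X Y, g x X Y = g x Y X
  g_pos : ∀ x X, X ≠ 0 → 0 < g x X X
  g_hermitian : ∀ x X Y, g x (J X) (J Y) = g x X Y
  Ψ_smooth : ∀ X Y Z, IsSmoothOnQuotient Γ (fun x => Ψ x X Y Z)
  frame_orthonormal : ∀ x i j, g x (frame x i) (frame x j) = if i = j then 1 else 0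
  frame_J : ∀ x, J (frame x 1) = frame x 0 ∧ J (frame x 3) = frame x 2 ∧
    J (frame x 5) = frame x 4
  frame_Ψ : ∀ x X Y Z, Ψ x X Y Z =
    Matrix.det !![complexForm (frame x) 0 1 X, complexForm (frame x) 0 1 Y,
                    complexForm (frame x) 0 1 Z;
                  complexForm (frame x) 2 3 X, complexForm (frame x) 2 3 Y,
                    complexForm (frame x) 2 3 Z;
                  complexForm (frame x) 4 5 X, complexForm (frame x) 4 5 Y,
                    complexForm (frame x) 4 5 Z]

namespace SU3Structure

variable {Γ : Subgroup G} {J : Alg G →ₗ[ℝ] Alg G} (S : SU3Structure Γ J)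

/-- The fundamental form `F(X,Y) = g(X,JY)`. -/
def F (x : G) (X Y : Alg G) : ℝ := S.g x X (J Y)

/-- The exterior derivative of the fundamental form. -/
def dF (x : G) (X Y Z : Alg G) : ℝ := extDeriv2 S.F x X Y Z

/-- The torsion 3-form (flux) `T = J dF`, that is `T(X,Y,Z) = -dF(JX,JY,JZ)`. -/
def T (x : G) (X Y Z : Alg G) : ℝ := -S.dF x (J X) (J Y) (J Z)

/-- The Levi-Civita connection, by the Koszul formula. -/
def leviCivita : Conn G := fun x X Y =>
  ∑ i, ((1 / 2 : ℝ) *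
    (der X (fun y => S.g y Y (S.frame x i)) x + der Y (fun y => S.g y X (S.frame x i)) x
      - der (S.frame x i) (fun y => S.g y X Y) x
      + S.g x ⁅X, Y⁆ (S.frame x i) - S.g x ⁅X, S.frame x i⁆ Y
      - S.g x ⁅Y, S.frame x i⁆ X)) • S.frame x i

/-- The Bismut connection: `g(∇⁺_X Y, Z) = g(∇^g_X Y, Z) + ½ T(X,Y,Z)`. -/
def bismut : Conn G := fun x X Y =>
  S.leviCivita x X Y + ∑ i, ((1 / 2 : ℝ) * S.T x X Y (S.frame x i)) • S.frame x i

/-- The Chern connection: `g(∇^c_X Y, Z) = g(∇^g_X Y, Z) + ½ dF(JX,Y,Z)`. -/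
def chern : Conn G := fun x X Y =>
  S.leviCivita x X Y + ∑ i, ((1 / 2 : ℝ) * S.dF x (J X) Y (S.frame x i)) • S.frame x i

/-- The covariant derivative `(∇^g_X F)(Y,Z)`. -/
def nablaF (x : G) (X Y Z : Alg G) : ℝ :=
  der X (fun y => S.F y Y Z) x - S.F x (S.leviCivita x X Y) Z - S.F x Y (S.leviCivita x X Z)

/-- The codifferential `δF(X) = -∑ᵢ (∇^g_{eᵢ} F)(eᵢ, X)`. -/
def codiffF (x : G) (X : Alg G) : ℝ :=
  -∑ i, S.nablaF x (S.frame x i) (S.frame x i) X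

/-- The Lee form `θ = 1/(1-n) J δF`, for `n = 3`, where `(Jα)(X) = -α(JX)`. -/
def lee (x : G) (X : Alg G) : ℝ := (1 / (1 - 3) : ℝ) * (-S.codiffF x (J X))

/-- The curvature forms `Ω^i_j(X,Y) = g(R(X,Y)e_j, e_i)` of a connection in an adapted basis. -/
def curvForm (D : Conn G) (x : G) (i j : Fin 6) (X Y : Alg G) : ℝ :=
  S.g x (curvature D x X Y (S.frame x j)) (S.frame x i)

/-- The first Pontrjagin form `p₁ = 1/(8π²) ∑_{i<j} Ω^i_j ∧ Ω^i_j` of a metric connection. -/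
def p1 (D : Conn G) (x : G) (X Y Z W : Alg G) : ℝ :=
  1 / (8 * Real.pi ^ 2) *
    ∑ i, ∑ j, if i < j then wedgeSq (S.curvForm D x i j) X Y Z W else 0

/-- The group SU(3) of the structure at `x`: the linear maps preserving `g`, `J` and `Ψ`. -/
def su3Group (x : G) : Set (Alg G →ₗ[ℝ] Alg G) :=
  {L | (∀ X Y, S.g x (L X) (L Y) = S.g x X Y) ∧ (∀ X, L (J X) = J (L X)) ∧
    ∀ X Y Z, S.Ψ x (L X) (L Y) (L Z) = S.Ψ x X Y Z}

/-- `A` is a smooth SU(3)-connection on the tangent bundle of `Γ\G`: the tensors `g`, `J`, `Ψ`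
are parallel. -/
structure IsSU3Connection (A : G → Alg G →ₗ[ℝ] Alg G →ₗ[ℝ] Alg G) : Prop where
  smooth : ∀ X Y, IsSmoothOnQuotient (V := E6) Γ (fun x => A x X Y)
  metric : ∀ x X Y Z, der X (fun y => S.g y Y Z) x = S.g x (A x X Y) Z + S.g x Y (A x X Z)
  complex : ∀ x X Y, A x X (J Y) = J (A x X Y)
  volume : ∀ x X Y Z W, der X (fun y => S.Ψ y Y Z W) x =
    S.Ψ x (A x X Y) Z W + S.Ψ x Y (A x X Z) W + S.Ψ x Y Z (A x X W)

/-- The underlying connection of a family of bilinear maps. -/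
def toConn (A : G → Alg G →ₗ[ℝ] Alg G →ₗ[ℝ] Alg G) : Conn G := fun x X Y => A x X Y

/-- `A` is an SU(3)-instanton: an SU(3)-connection whose curvature 2-form is in `𝔰𝔲(3)`,
i.e. of type (1,1) and with vanishing contraction with `F`. -/
structure IsInstanton (A : G → Alg G →ₗ[ℝ] Alg G →ₗ[ℝ] Alg G) : Prop where
  su3 : S.IsSU3Connection A
  type11 : ∀ x i j X Y, S.curvForm (toConn A) x i j (J X) (J Y) = S.curvForm (toConn A) x i j X Y
  primitive : ∀ x i j,
    S.curvForm (toConn A) x i j (S.frame x 0) (S.frame x 1)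
      + S.curvForm (toConn A) x i j (S.frame x 2) (S.frame x 3)
      + S.curvForm (toConn A) x i j (S.frame x 4) (S.frame x 5) = 0

/-- The heterotic supersymmetry equations for an SU(3)-structure with holomorphic `Ψ`, dilaton
`φ`, instanton `A` and constant `α'`, with the Chern connection in the anomaly cancellation
condition. -/
structure SolvesHeterotic (φ : G → ℝ) (A : G → Alg G →ₗ[ℝ] Alg G →ₗ[ℝ] Alg G) (α' : ℝ) :
    Prop where
  /-- `Ψ` is a holomorphic, i.e. closed, (3,0)-form. -/
  holomorphic : ∀ x X Y Z W, extDeriv3 S.Ψ x X Y Z W = 0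
  /-- Gravitino equation: the holonomy of the Bismut connection is contained in SU(3). -/
  gravitino : ∀ x L, IsHolonomy Γ S.bismut x L → L ∈ S.su3Group x
  dilaton_smooth : IsSmoothOnQuotient Γ φ
  /-- Dilatino equation: the Lee form is `θ = 2 dφ`. -/
  dilatino : ∀ x X, S.lee x X = 2 * der X φ x
  /-- Gaugino equation. -/
  gaugino : S.IsInstanton A
  alpha_pos : 0 < α'
  /-- Anomaly cancellation: `dT = 2π² α' (p₁(∇^c) - p₁(A))`. -/
  anomaly : ∀ x X Y Z W, extDeriv3 S.T x X Y Z W =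
    2 * Real.pi ^ 2 * α' * (S.p1 S.chern x X Y Z W - S.p1 (toConn A) x X Y Z W)

end SU3Structure

end Heterotic

end

/-! Up to choosing a good basis there is only one complex structure to treat. Any `J` on the algebra
admits a basis with `J e₁ = e₀`, `J e₃ = e₂`, `J e₅ = e₄` whose only brackets are `[e₄,e₀] = p e₂`,
`[e₄,e₁] = p e₃`, `[e₀,e₂] = [e₁,e₃] = q e₅`, and rescaling the basis leaves `p` and `|q|` free
(`IsComplexStructure.exists_adaptedBasis`). Declare this basis orthonormal and left-invariant. All
tensors then have constant coefficients, so they descend to the quotient and every equation becomes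
polynomial algebra in `p`, `q`. For all `p`, `q`, `Ψ` is closed, the Lee form vanishes and the
Bismut connection is 𝔰𝔲(3)-valued, so `φ = 0` works. As instanton take `2 e⁵ ⊗ M` with `M` in a
torus of 𝔰𝔲(3): its curvature is `2 de⁵ ⊗ M`, and `de⁵ = -q(e⁰² + e¹³)` is a primitive (1,1)-form.
Anomaly cancellation compares the coefficients of `e⁰¹²³` and `e⁰¹⁴⁵` in `-2q² e⁰¹²³ - 2p² e⁰¹⁴⁵ =
(α'/4) ((16q² - p²q²) e⁰¹²³ - p²q² e⁰¹⁴⁵)`. For nonzero `p`, `q` this says `α' q² = 8` and `p² = q²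
+ 16`, which `p = 5`, `q = ±3`, `α' = 8/9` satisfy. -/

namespace Heterotic

/-! ### Normal form of complex structures on the algebra -/

section Algebra

variable {L : Type*} [AddCommGroup L] [Module ℝ L] [Bracket L L]

/-- A basis adapted to a complex structure in which the bracket has the normal form
`[e₄,e₀] = p e₂`, `[e₄,e₁] = p e₃`, `[e₀,e₂] = [e₁,e₃] = q e₅`. -/
structure IsAdaptedBasis (J : L →ₗ[ℝ] L) (e : Module.Basis (Fin 6) ℝ L) (p q : ℝ) : Prop where
  J_one : J (e 1) = e 0
  J_three : J (e 3) = e 2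
  J_five : J (e 5) = e 4
  J_sq : ∀ X, J (J X) = -X
  bracket : ∀ X Y : L, ⁅X, Y⁆ =
    (p * (e.coord 4 X * e.coord 0 Y - e.coord 0 X * e.coord 4 Y)) • e 2
    + (p * (e.coord 4 X * e.coord 1 Y - e.coord 1 X * e.coord 4 Y)) • e 3
    + (q * (e.coord 0 X * e.coord 2 Y - e.coord 2 X * e.coord 0 Y
      + e.coord 1 X * e.coord 3 Y - e.coord 3 X * e.coord 1 Y)) • e 5

/-- `Bracket` carries no laws. The structure equations determine the bracket completely, which
yields a bilinear map `B` to compute with. -/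
theorem IsAlgebraN.exists_bracket (h : IsAlgebraN L) :
    ∃ (b : Module.Basis (Fin 6) ℝ L) (c : Fin 6 → L →ₗ[ℝ] ℝ) (B : L →ₗ[ℝ] L →ₗ[ℝ] L),
      (∀ i j, c i (b j) = if j = i then 1 else 0) ∧
      (∀ X, X = ∑ i, c i X • b i) ∧
      (∀ X Y : L, ⁅X, Y⁆ = B X Y) ∧
      ∀ X Y : L, B X Y =
        (c 1 X * c 0 Y - c 0 X * c 1 Y) • b 3
        + (c 2 X * c 1 Y - c 1 X * c 2 Y) • b 4
        + (c 3 X * c 0 Y - c 0 X * c 3 Y + c 2 X * c 4 Y - c 4 X * c 2 Y) • b 5 := by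
  obtain ⟨b, hb⟩ := h
  refine ⟨b, b.coord, LinearMap.mk₂ ℝ (fun X Y =>
        (b.coord 1 X * b.coord 0 Y - b.coord 0 X * b.coord 1 Y) • b 3
        + (b.coord 2 X * b.coord 1 Y - b.coord 1 X * b.coord 2 Y) • b 4
        + (b.coord 3 X * b.coord 0 Y - b.coord 0 X * b.coord 3 Y
            + b.coord 2 X * b.coord 4 Y - b.coord 4 X * b.coord 2 Y) • b 5)
        ?_ ?_ ?_ ?_, fun i j => by simp [Finsupp.single_apply],
        fun X => (b.sum_repr X).symm, ?_, fun X Y => rfl⟩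
  · intro X X' Y; simp only [map_add]; module
  · intro c X Y; simp only [map_smul, smul_eq_mul]; module
  · intro X Y Y'; simp only [map_add]; module
  · intro c X Y; simp only [map_smul, smul_eq_mul]; module
  · intro X Y
    rw [LinearMap.mk₂_apply]
    obtain ⟨h0, h1, h2, h3, h4, h5⟩ := hb X Y
    apply b.ext_elem
    intro i
    simp only [Module.Basis.coord_apply] at *
    fin_cases i <;> simp <;> linarith

/-- The central vector `b 5` and `W = J (b 5)` span a `J`-invariant plane, and the Nijenhuis
condition makes `ad W` commute with `J`. Hence `ad W` carries the complex line of `b 0`, suitably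
corrected, to a third complex line, and these three lines give the basis. -/
theorem IsComplexStructure.exists_adaptedBasis (h : IsAlgebraN L) {J : L →ₗ[ℝ] L}
    (hJ : IsComplexStructure J) :
    ∃ (e : Module.Basis (Fin 6) ℝ L) (q : ℝ), q ^ 2 = 9 ∧ IsAdaptedBasis J e 5 q := by
  obtain ⟨b, c, B, hc, hrepr, hB, hb⟩ := h.exists_bracket
  have hN : ∀ X Y, B (J X) (J Y) = J (B (J X) Y) + J (B X (J Y)) + B X Y := by
    intro X Y; simpa only [hB] using hJ.nijenhuis X Y
  have hskew : ∀ X Y, B X Y = -B Y X := by intro X Y; rw [hb, hb]; module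
  have hsq := hJ.sq
  have hZ : ∀ X, B X (b 5) = 0 := by intro X; rw [hb]; simp [hc]
  -- `J b₅` is not a multiple of `b₅`
  have hne : ∀ r s : ℝ, r • J (b 5) = s • b 5 → r = 0 ∧ s = 0 := by
    intro r s hrs
    have h1 : r • (b 5) = -(s • J (b 5)) := by
      have := congrArg J hrs
      simp only [map_smul, hsq] at this
      rw [← this]; module
    have h2 : (r ^ 2 + s ^ 2) • b 5 = 0 := by
      have : r • (r • b 5) = -(s • (r • J (b 5))) := by rw [h1]; module
      rw [hrs] at this
      linear_combination (norm := module) this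
    have h3 : r ^ 2 + s ^ 2 = 0 := by
      have := congrArg (c 5) h2
      simpa [hc] using this
    constructor <;> nlinarith [sq_nonneg r, sq_nonneg s]
  set W := J (b 5) with hW
  have hA : ∀ X, B (J X) W = J (B X W) := by
    intro X
    have := hN X (b 5)
    rw [hZ, hZ] at this
    simpa using this
  have hAW : ∀ X, B X W = (c 1 X * c 0 W - c 0 X * c 1 W) • b 3
        + (c 2 X * c 1 W - c 1 X * c 2 W) • b 4
        + (c 3 X * c 0 W - c 0 X * c 3 W
            + c 2 X * c 4 W - c 4 X * c 2 W) • b 5 := fun X => hb X W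
  have hAAW : ∀ X, B (B X W) W =
      (c 1 X * (c 0 W ^ 2 + c 2 W ^ 2)
        - c 1 W * (c 0 X * c 0 W + c 2 X * c 2 W)) • b 5 := by
    intro X
    rw [hAW (B X W), hAW X]
    simp [hc]
    module
  -- `(ad W)²` commutes with `J` but takes values in the line of `b 5`, which is not `J`-invariant,
  -- so it vanishes. Its value on `b 1` has a sum of squares as coefficient.
  have hW02 : c 0 W = 0 ∧ c 2 W = 0 := by
    have h1 : B (B (J (b 1)) W) W = J (B (B (b 1) W) W) := by rw [hA, hA]
    rw [hAAW, hAAW, map_smul] at h1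
    have h2 := (hne _ _ h1.symm).1
    simp [hc] at h2
    constructor <;> nlinarith [sq_nonneg (c 0 W), sq_nonneg (c 2 W)]
  obtain ⟨hW0, hW2⟩ := hW02
  -- Otherwise `ad W` itself maps into the line of `b 5`, hence is zero. Then `W` is central and so
  -- a multiple of `b 5`.
  have hW1 : c 1 W ≠ 0 := by
    intro hW1
    have key : ∀ X, c 2 X * c 4 W - c 0 X * c 3 W = 0 := by
      intro X
      have h1 := hA X
      rw [hAW, hAW X] at h1
      simp only [hW0, hW1, hW2, map_add, map_smul] at h1
      norm_num at h1
      have h2 := (hne _ _ h1.symm).1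
      linarith
    have h3 : c 3 W = 0 := by simpa [hc] using key (b 0)
    have h4 : c 4 W = 0 := by simpa [hc] using key (b 2)
    have h5 : W = c 5 W • b 5 := by
      conv_lhs => rw [hrepr W]
      simp only [Fin.sum_univ_six, hW0, hW1, hW2, h3, h4, zero_smul, zero_add]
    have := hne 1 _ (by rw [one_smul]; exact h5)
    exact one_ne_zero this.1
  set w := c 1 W with hw
  set w3 := c 3 W
  set w4 := c 4 W
  have hWX : ∀ X, B W X = (w * c 0 X) • b 3 - (w * c 2 X) • b 4
      + (w3 * c 0 X - w4 * c 2 X) • b 5 := by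
    intro X
    rw [hskew, hAW, hW0, hW2]
    module
  have hWJ : ∀ X, B W (J X) = J (B W X) := by
    intro X; rw [hskew, hA, hskew X W, map_neg, neg_neg]
  have hWb0 : B W (b 0) = w • b 3 + w3 • b 5 := by rw [hWX]; simp [hc]
  set Y := J (b 0) with hY
  -- compatibility of `J` with the form `(X, Y) ↦ [X, [W, Y]]`
  have hY02 : c 0 Y = 0 ∧ c 2 Y ^ 2 = 1 := by
    -- Here `[X,[W,Z]] = -w (c 0 X * c 0 Z + c 2 X * c 2 Z) b 5`, a semidefinite form; independence
    -- of `b 5` and `W` separates the two resulting conditions.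
    have h1 := hN (b 0) (B W (b 0))
    rw [← hWJ, ← hY, hWb0, hWX Y] at h1
    have e1 : B Y ((w * c 0 Y) • b 3 - (w * c 2 Y) • b 4
      + (w3 * c 0 Y - w4 * c 2 Y) • b 5) =
      (-w * (c 0 Y ^ 2 + c 2 Y ^ 2)) • b 5 := by
      rw [hb]
      simp [hc]
      try module
    have e2 : B Y (w • b 3 + w3 • b 5) = (-w * c 0 Y) • b 5 := by
      rw [hb]
      simp [hc]
      try module
    have e3 : B (b 0) ((w * c 0 Y) • b 3 - (w * c 2 Y) • b 4
      + (w3 * c 0 Y - w4 * c 2 Y) • b 5) = (-w * c 0 Y) • b 5 := by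
      rw [hb]
      simp [hc]
      try module
    have e4 : B (b 0) (w • b 3 + w3 • b 5) = (-w) • b 5 := by
      rw [hb]
      simp [hc]
      try module
    rw [e1, e2, e3, e4, map_smul, ← hW] at h1
    obtain ⟨h2, h3⟩ := hne (2 * w * c 0 Y) (w * (c 0 Y ^ 2 + c 2 Y ^ 2 - 1))
      (by linear_combination (norm := module) h1)
    have h4 : c 0 Y = 0 := by simpa [hW1] using h2
    have h5 := (mul_eq_zero.mp h3).resolve_left hW1
    rw [h4] at h5
    exact ⟨h4, by linarith⟩
  obtain ⟨hY0, hY2⟩ := hY02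
  set y := c 2 Y with hy
  set y1 := c 1 Y
  set y3 := c 3 Y
  set U := B W (b 0) with hU
  set U' := B W Y with hU'
  have hUe : U = w • b 3 + w3 • b 5 := hWb0
  have hU'e : U' = (-w * y) • b 4 + (-w4 * y) • b 5 := by
    rw [hU', hWX, hY0]; module
  have hJU : J U = U' := by rw [hU, hU', hY, hWJ]
  -- The corrections `s` and `v` make `f 0` and `f 1` commute: `[Y, b 0]` has components along `b 3`
  -- and `b 5`, which are cancelled by `s` and by `v` respectively.
  set s := -y1 / w with hs
  set v := (y3 + s * w3) / (2 * w) with hv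
  have hs' : s * w = -y1 := by rw [hs]; field_simp
  have hv' : v * w = y3 + s * w3 - v * w := by
    have : v * (2 * w) = y3 + s * w3 := by rw [hv]; field_simp
    linarith
  -- The brackets will give `q = -m² w / 5`, so 15 is what makes `|q| = 3`; the sign of `q` follows
  -- that of `w` and is irrelevant.
  have hμ : ∃ m : ℝ, m ^ 2 * |w| = 15 := by
    have : 0 < |w| := abs_pos.mpr hW1
    refine ⟨Real.sqrt (15 / |w|), ?_⟩
    rw [Real.sq_sqrt (by positivity)]
    field_simp
  obtain ⟨m, hm⟩ := hμ
  have hm0 : m ≠ 0 := by rintro rfl; norm_num at hm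
  have hy0 : y ≠ 0 := by intro h0; rw [h0] at hY2; norm_num at hY2
  -- The factor `m / 5`, against `m` in the first two vectors, gives `p = 5`, since `U' = [W, Y]`
  -- and `U = [W, b 0]`.
  let f : Fin 6 → L := ![m • (Y + s • W - v • U), m • (b 0 + s • b 5 + v • U'),
    (m / 5) • U', (m / 5) • U, W, b 5]
  have cU : ∀ i, c i U = w * c i (b 3) + w3 * c i (b 5) := by intro i; rw [hUe]; simp
  have cU' : ∀ i, c i U' = (-w * y) * c i (b 4) + (-w4 * y) * c i (b 5) := by
    intro i; rw [hU'e]; simp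
  -- These old coordinates of a combination of the `f i` serve twice: solved successively they give
  -- independence, and substituted into `B` they give the bracket.
  have hf0 : ∀ g : Fin 6 → ℝ, c 0 (∑ i, g i • f i) = m * g 1 := by
    intro g
    simp only [Fin.sum_univ_six, map_add, map_smul, map_sub, smul_eq_mul, f, Matrix.cons_val]
    rw [cU, cU', hW0, hY0]; simp [hc]; ring
  have hf1 : ∀ g : Fin 6 → ℝ, c 1 (∑ i, g i • f i) = w * g 4 := by
    intro g
    simp only [Fin.sum_univ_six, map_add, map_smul, map_sub, smul_eq_mul, f, Matrix.cons_val]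
    rw [cU, cU', ← hw]; simp [hc]; linear_combination g 0 * m * hs'
  have hf2 : ∀ g : Fin 6 → ℝ, c 2 (∑ i, g i • f i) = m * y * g 0 := by
    intro g
    simp only [Fin.sum_univ_six, map_add, map_smul, map_sub, smul_eq_mul, f, Matrix.cons_val]
    rw [cU, cU', hW2, ← hy]; simp [hc]; ring
  have hf3 : ∀ g : Fin 6 → ℝ, c 3 (∑ i, g i • f i) =
      m * (v * w) * g 0 + m / 5 * w * g 3 + w3 * g 4 := by
    intro g
    simp only [Fin.sum_univ_six, map_add, map_smul, map_sub, smul_eq_mul, f, Matrix.cons_val]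
    rw [cU, cU']; simp [hc]; linear_combination -g 0 * m * hv'
  have hf4 : ∀ g : Fin 6 → ℝ, c 4 (∑ i, g i • f i) =
      m * (c 4 Y + s * w4) * g 0 - m * v * w * y * g 1 - m / 5 * w * y * g 2 + w4 * g 4 := by
    intro g
    simp only [Fin.sum_univ_six, map_add, map_smul, map_sub, smul_eq_mul, f, Matrix.cons_val]
    rw [cU, cU']; simp [hc]; ring
  have hli : LinearIndependent ℝ f := by
    rw [Fintype.linearIndependent_iff]
    intro g hg
    have g1 : g 1 = 0 := by simpa [hg, hm0] using hf0 g
    have g4 : g 4 = 0 := by simpa [hg, hW1] using hf1 g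
    have g0 : g 0 = 0 := by simpa [hg, hm0, hy0] using hf2 g
    have g3 : g 3 = 0 := by simpa [hg, hm0, hW1, g0, g4] using hf3 g
    have g2 : g 2 = 0 := by simpa [hg, hm0, hW1, hy0, g0, g1, g4] using hf4 g
    have g5 : g 5 = 0 := by
      have := congrArg (c 5) hg
      simpa [Fin.sum_univ_six, g0, g1, g2, g3, g4, f, hc] using this
    intro i; fin_cases i <;> assumption
  let e := basisOfLinearIndependentOfCardEqFinrank hli (Module.finrank_eq_card_basis b).symm
  have he : ∀ i, e i = f i := fun i => by simp [e]
  have hX : ∀ X, ∑ i, e.coord i X • f i = X := by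
    intro X
    conv_rhs => rw [← e.sum_repr X]
    exact Finset.sum_congr rfl fun i _ => by rw [he]; rfl
  have hJU' : J U' = -U := by rw [← hJU, hsq]
  refine ⟨e, -(m ^ 2 * w / 5), ?_, ?_, ?_, ?_, hsq, ?_⟩
  · have : (m ^ 2 * |w|) ^ 2 = 15 ^ 2 := by rw [hm]
    rw [mul_pow, sq_abs] at this
    linear_combination this / 25
  · rw [he, he]
    simp only [f, Matrix.cons_val, map_add, map_smul, hJU', ← hY, ← hW]
    module
  · rw [he, he]
    simp only [f, Matrix.cons_val, map_smul, hJU]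
  · rw [he, he]
    simp only [f, Matrix.cons_val, ← hW]
  · intro X X'
    have k0 := hf0 (fun i => e.coord i X)
    have k1 := hf1 (fun i => e.coord i X)
    have k2 := hf2 (fun i => e.coord i X)
    have k3 := hf3 (fun i => e.coord i X)
    have k4 := hf4 (fun i => e.coord i X)
    have l0 := hf0 (fun i => e.coord i X')
    have l1 := hf1 (fun i => e.coord i X')
    have l2 := hf2 (fun i => e.coord i X')
    have l3 := hf3 (fun i => e.coord i X')
    have l4 := hf4 (fun i => e.coord i X')
    rw [hX] at k0 k1 k2 k3 k4 l0 l1 l2 l3 l4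
    rw [hB, hb, k0, k1, k2, k3, k4, l0, l1, l2, l3, l4, he, he, he]
    simp only [f, Matrix.cons_val, hUe, hU'e]
    generalize e.coord 0 X = x0
    generalize e.coord 1 X = x1
    generalize e.coord 2 X = x2
    generalize e.coord 3 X = x3
    generalize e.coord 4 X = x4
    generalize e.coord 0 X' = y0
    generalize e.coord 1 X' = y1'
    generalize e.coord 2 X' = y2'
    generalize e.coord 3 X' = y3'
    generalize e.coord 4 X' = y4'
    have hy2 : (y ^ 2 - 1) • b 5 = 0 := by rw [hY2]; simp
    linear_combination (norm := module)
      (-(m ^ 2 * v * w) * (x0 * y1' - x1 * y0) - m ^ 2 / 5 * w * (x0 * y2' - x2 * y0)) • hy2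

end Algebra

/-! ### Left-invariant tensors and the invariant SU(3)-structure -/

variable {G : Type*} [Group G] [TopologicalSpace G] [ChartedSpace E6 G]

@[simp] theorem der_const {V : Type*} [NormedAddCommGroup V] [NormedSpace ℝ V]
    (X : Alg G) (v : V) (x : G) : der X (fun _ : G => v) x = 0 := by
  rw [der, mfderiv_const]; rfl

@[simp] theorem derVec_const (X W : Alg G) (x : G) : derVec X (fun _ : G => W) x = 0 :=
  der_const (V := E6) X W x

theorem isSmoothOnQuotient_const (Γ : Subgroup G) {V : Type*} [NormedAddCommGroup V]
    [NormedSpace ℝ V] (v : V) : IsSmoothOnQuotient Γ (fun _ : G => v) :=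
  ⟨contMDiff_const, fun _ _ _ => rfl⟩

theorem curvature_const (D : Alg G → Alg G → Alg G) (x : G) (X Y Z : Alg G) :
    curvature (fun _ => D) x X Y Z = D X (D Y Z) - D Y (D X Z) - D ⁅X, Y⁆ Z := by
  simp [curvature, covDeriv]

theorem coord_basis {L : Type*} [AddCommGroup L] [Module ℝ L] (e : Module.Basis (Fin 6) ℝ L)
    (i j : Fin 6) : e.coord i (e j) = if j = i then 1 else 0 := by
  simp [Finsupp.single_apply]

theorem coord_sum_smul {L : Type*} [AddCommGroup L] [Module ℝ L]
    (e : Module.Basis (Fin 6) ℝ L) (a : Fin 6 → ℝ) (k : Fin 6) :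
    e.coord k (∑ i, a i • e i) = a k := by
  rw [map_sum]
  simp [Finsupp.single_apply]

/-- The inner product for which a basis is orthonormal. -/
noncomputable def basisMetric {L : Type*} [AddCommGroup L] [Module ℝ L]
    (e : Module.Basis (Fin 6) ℝ L) : LinearMap.BilinForm ℝ L :=
  LinearMap.mk₂ ℝ (fun X Y => ∑ i, e.coord i X * e.coord i Y)
    (by intro X X' Y; simp [add_mul, Finset.sum_add_distrib])
    (by intro c X Y; simp [mul_assoc, Finset.mul_sum])
    (by intro X Y Y'; simp [mul_add, Finset.sum_add_distrib])
    (by intro c X Y; simp [mul_left_comm, Finset.mul_sum])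

theorem basisMetric_apply {L : Type*} [AddCommGroup L] [Module ℝ L]
    (e : Module.Basis (Fin 6) ℝ L) (X Y : L) :
    basisMetric e X Y = ∑ i, e.coord i X * e.coord i Y := rfl

theorem basisMetric_basis_right {L : Type*} [AddCommGroup L] [Module ℝ L]
    (e : Module.Basis (Fin 6) ℝ L) (X : L) (i : Fin 6) :
    basisMetric e X (e i) = e.coord i X := by
  simp [basisMetric_apply, Finsupp.single_apply]

namespace IsAdaptedBasis

section Coordinates

variable {L : Type*} [AddCommGroup L] [Module ℝ L] [Bracket L L] {J : L →ₗ[ℝ] L}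
  {e : Module.Basis (Fin 6) ℝ L} {p q : ℝ} (h : IsAdaptedBasis J e p q)

include h

theorem J_zero : J (e 0) = -e 1 := by rw [← h.J_one, h.J_sq]

theorem J_two : J (e 2) = -e 3 := by rw [← h.J_three, h.J_sq]

theorem J_four : J (e 4) = -e 5 := by rw [← h.J_five, h.J_sq]

theorem J_apply (X : L) : J X = e.coord 1 X • e 0 - e.coord 0 X • e 1
    + e.coord 3 X • e 2 - e.coord 2 X • e 3 + e.coord 5 X • e 4 - e.coord 4 X • e 5 := by
  conv_lhs => rw [← e.sum_repr X]
  simp only [Fin.sum_univ_six, map_add, map_smul, h.J_zero, h.J_one, h.J_two, h.J_three,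
    h.J_four, h.J_five, Module.Basis.coord_apply]
  module

theorem coord_J (X : L) : e.coord 0 (J X) = e.coord 1 X ∧ e.coord 1 (J X) = -e.coord 0 X ∧
    e.coord 2 (J X) = e.coord 3 X ∧ e.coord 3 (J X) = -e.coord 2 X ∧
    e.coord 4 (J X) = e.coord 5 X ∧ e.coord 5 (J X) = -e.coord 4 X := by
  rw [h.J_apply]
  simp only [map_add, map_sub, map_smul, coord_basis]
  simp

theorem coord_bracket (X Y : L) : e.coord 0 ⁅X, Y⁆ = 0 ∧ e.coord 1 ⁅X, Y⁆ = 0 ∧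
    e.coord 2 ⁅X, Y⁆ = p * (e.coord 4 X * e.coord 0 Y - e.coord 0 X * e.coord 4 Y) ∧
    e.coord 3 ⁅X, Y⁆ = p * (e.coord 4 X * e.coord 1 Y - e.coord 1 X * e.coord 4 Y) ∧
    e.coord 4 ⁅X, Y⁆ = 0 ∧
    e.coord 5 ⁅X, Y⁆ = q * (e.coord 0 X * e.coord 2 Y - e.coord 2 X * e.coord 0 Y
      + e.coord 1 X * e.coord 3 Y - e.coord 3 X * e.coord 1 Y) := by
  rw [h.bracket]
  simp only [map_add, map_smul, coord_basis]
  simp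

end Coordinates

variable {J : Alg G →ₗ[ℝ] Alg G} {e : Module.Basis (Fin 6) ℝ (Alg G)} {p q : ℝ}

/-- The left-invariant SU(3)-structure with a given adapted basis. -/
noncomputable def su3Structure (h : IsAdaptedBasis J e p q) (Γ : Subgroup G) :
    SU3Structure Γ J where
  g _ := basisMetric e
  Ψ _ X Y Z :=
    Matrix.det !![complexForm e 0 1 X, complexForm e 0 1 Y, complexForm e 0 1 Z;
                  complexForm e 2 3 X, complexForm e 2 3 Y, complexForm e 2 3 Z;
                  complexForm e 4 5 X, complexForm e 4 5 Y, complexForm e 4 5 Z]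
  frame _ := e
  g_smooth X Y := isSmoothOnQuotient_const Γ _
  g_symm x X Y := by simp only [basisMetric_apply, mul_comm]
  g_pos x X hX := by
    rw [basisMetric_apply]
    apply lt_of_le_of_ne (Finset.sum_nonneg fun i _ => mul_self_nonneg _)
    intro h0
    apply hX
    apply e.ext_elem
    intro i
    have := (Finset.sum_eq_zero_iff_of_nonneg
      (fun i _ => mul_self_nonneg (e.coord i X))).mp h0.symm i (Finset.mem_univ i)
    simpa using this
  g_hermitian x X Y := by
    obtain ⟨h0, h1, h2, h3, h4, h5⟩ := h.coord_J X
    obtain ⟨k0, k1, k2, k3, k4, k5⟩ := h.coord_J Y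
    simp only [basisMetric_apply, Fin.sum_univ_six, *]
    ring
  Ψ_smooth X Y Z := isSmoothOnQuotient_const Γ _
  frame_orthonormal x i j := by
    rw [basisMetric_basis_right, coord_basis]
  frame_J x := ⟨h.J_one, h.J_three, h.J_five⟩
  frame_Ψ x X Y Z := rfl

/-! ### Torsion and the Levi-Civita, Chern and Bismut connections -/

variable (h : IsAdaptedBasis J e p q) (Γ : Subgroup G)

theorem g_eq (x : G) (X Y : Alg G) : (h.su3Structure Γ).g x X Y =
    e.coord 0 X * e.coord 0 Y + e.coord 1 X * e.coord 1 Y + e.coord 2 X * e.coord 2 Y +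
    e.coord 3 X * e.coord 3 Y + e.coord 4 X * e.coord 4 Y + e.coord 5 X * e.coord 5 Y := by
  change basisMetric e X Y = _
  rw [basisMetric_apply, Fin.sum_univ_six]

theorem F_eq (x : G) (X Y : Alg G) : (h.su3Structure Γ).F x X Y =
    e.coord 0 X * e.coord 1 Y - e.coord 1 X * e.coord 0 Y + (e.coord 2 X * e.coord 3 Y -
    e.coord 3 X * e.coord 2 Y) + (e.coord 4 X * e.coord 5 Y - e.coord 5 X * e.coord 4 Y) := by
  obtain ⟨k0, k1, k2, k3, k4, k5⟩ := h.coord_J Y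
  rw [SU3Structure.F, g_eq, k0, k1, k2, k3, k4, k5]
  ring

theorem dF_eq_F (x : G) (X Y Z : Alg G) : (h.su3Structure Γ).dF x X Y Z =
    -(h.su3Structure Γ).F x ⁅X, Y⁆ Z + (h.su3Structure Γ).F x ⁅X, Z⁆ Y
      - (h.su3Structure Γ).F x ⁅Y, Z⁆ X := by
  have hF : ∀ (y : G) (U V : Alg G), (h.su3Structure Γ).F y U V = basisMetric e U (J V) :=
    fun y U V => rfl
  simp only [SU3Structure.dF, extDeriv2, hF, der_const]
  ring

theorem dF_eq (x : G) (X Y Z : Alg G) : (h.su3Structure Γ).dF x X Y Z =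
    - (p * (e.coord 4 X * e.coord 0 Y - e.coord 0 X * e.coord 4 Y) * e.coord 3 Z
      - p * (e.coord 4 X * e.coord 1 Y - e.coord 1 X * e.coord 4 Y) * e.coord 2 Z
      - q * (e.coord 0 X * e.coord 2 Y - e.coord 2 X * e.coord 0 Y
        + e.coord 1 X * e.coord 3 Y - e.coord 3 X * e.coord 1 Y) * e.coord 4 Z)
    + (p * (e.coord 4 X * e.coord 0 Z - e.coord 0 X * e.coord 4 Z) * e.coord 3 Y
      - p * (e.coord 4 X * e.coord 1 Z - e.coord 1 X * e.coord 4 Z) * e.coord 2 Y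
      - q * (e.coord 0 X * e.coord 2 Z - e.coord 2 X * e.coord 0 Z
        + e.coord 1 X * e.coord 3 Z - e.coord 3 X * e.coord 1 Z) * e.coord 4 Y)
    - (p * (e.coord 4 Y * e.coord 0 Z - e.coord 0 Y * e.coord 4 Z) * e.coord 3 X
      - p * (e.coord 4 Y * e.coord 1 Z - e.coord 1 Y * e.coord 4 Z) * e.coord 2 X
      - q * (e.coord 0 Y * e.coord 2 Z - e.coord 2 Y * e.coord 0 Z
        + e.coord 1 Y * e.coord 3 Z - e.coord 3 Y * e.coord 1 Z) * e.coord 4 X) := by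
  obtain ⟨a0, a1, a2, a3, a4, a5⟩ := h.coord_bracket X Y
  obtain ⟨b0, b1, b2, b3, b4, b5⟩ := h.coord_bracket X Z
  obtain ⟨c0, c1, c2, c3, c4, c5⟩ := h.coord_bracket Y Z
  rw [dF_eq_F, F_eq, F_eq, F_eq, a0, a1, a2, a3, a4, a5, b0, b1, b2, b3, b4, b5,
    c0, c1, c2, c3, c4, c5]
  ring

/-- The flux, in coordinates: `T = p (e⁰³⁵ - e¹²⁵) - q (e⁰²⁵ + e¹³⁵)`. -/
theorem T_eq (x : G) (X Y Z : Alg G) : (h.su3Structure Γ).T x X Y Z =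
    ((p * (e.coord 0 X * e.coord 3 Y - e.coord 3 X * e.coord 0 Y
        - e.coord 1 X * e.coord 2 Y + e.coord 2 X * e.coord 1 Y)
      - q * (e.coord 0 X * e.coord 2 Y - e.coord 2 X * e.coord 0 Y
        + e.coord 1 X * e.coord 3 Y - e.coord 3 X * e.coord 1 Y)) * e.coord 5 Z
    - (p * (e.coord 0 X * e.coord 3 Z - e.coord 3 X * e.coord 0 Z
        - e.coord 1 X * e.coord 2 Z + e.coord 2 X * e.coord 1 Z)
      - q * (e.coord 0 X * e.coord 2 Z - e.coord 2 X * e.coord 0 Z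
        + e.coord 1 X * e.coord 3 Z - e.coord 3 X * e.coord 1 Z)) * e.coord 5 Y
    + (p * (e.coord 0 Y * e.coord 3 Z - e.coord 3 Y * e.coord 0 Z
        - e.coord 1 Y * e.coord 2 Z + e.coord 2 Y * e.coord 1 Z)
      - q * (e.coord 0 Y * e.coord 2 Z - e.coord 2 Y * e.coord 0 Z
        + e.coord 1 Y * e.coord 3 Z - e.coord 3 Y * e.coord 1 Z)) * e.coord 5 X) := by
  obtain ⟨a0, a1, a2, a3, a4, a5⟩ := h.coord_J X
  obtain ⟨b0, b1, b2, b3, b4, b5⟩ := h.coord_J Y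
  obtain ⟨c0, c1, c2, c3, c4, c5⟩ := h.coord_J Z
  rw [SU3Structure.T, dF_eq, a0, a1, a2, a3, a4, b0, b1, b2, b3, b4, c0, c1, c2, c3, c4]
  ring

theorem coord_leviCivita (x : G) (X Y : Alg G) (k : Fin 6) :
    e.coord k ((h.su3Structure Γ).leviCivita x X Y) = 1 / 2 *
      ((h.su3Structure Γ).g x ⁅X, Y⁆ (e k) - (h.su3Structure Γ).g x ⁅X, e k⁆ Y
        - (h.su3Structure Γ).g x ⁅Y, e k⁆ X) := by
  have hg : ∀ (y : G) (U V : Alg G), (h.su3Structure Γ).g y U V = basisMetric e U V :=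
    fun y U V => rfl
  have hf : ∀ y : G, (h.su3Structure Γ).frame y = e := fun y => rfl
  simp only [SU3Structure.leviCivita, hg, hf, der_const, coord_sum_smul]
  ring

theorem coord_chern (x : G) (X Y : Alg G) (k : Fin 6) :
    e.coord k ((h.su3Structure Γ).chern x X Y) =
      e.coord k ((h.su3Structure Γ).leviCivita x X Y)
        + 1 / 2 * (h.su3Structure Γ).dF x (J X) Y (e k) := by
  have hf : (h.su3Structure Γ).frame x = e := rfl
  rw [SU3Structure.chern, map_add, hf, coord_sum_smul]

theorem coord_bismut (x : G) (X Y : Alg G) (k : Fin 6) :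
    e.coord k ((h.su3Structure Γ).bismut x X Y) =
      e.coord k ((h.su3Structure Γ).leviCivita x X Y)
        + 1 / 2 * (h.su3Structure Γ).T x X Y (e k) := by
  have hf : (h.su3Structure Γ).frame x = e := rfl
  rw [SU3Structure.bismut, map_add, hf, coord_sum_smul]

theorem leviCivita_eq (x : G) (X Y : Alg G) :
    e.coord 0 ((h.su3Structure Γ).leviCivita x X Y) =
      1 / 2 * (-p * (e.coord 4 X * e.coord 2 Y + e.coord 2 X * e.coord 4 Y)
        + q * (e.coord 2 X * e.coord 5 Y + e.coord 5 X * e.coord 2 Y)) ∧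
    e.coord 1 ((h.su3Structure Γ).leviCivita x X Y) =
      1 / 2 * (-p * (e.coord 4 X * e.coord 3 Y + e.coord 3 X * e.coord 4 Y)
        + q * (e.coord 3 X * e.coord 5 Y + e.coord 5 X * e.coord 3 Y)) ∧
    e.coord 2 ((h.su3Structure Γ).leviCivita x X Y) =
      1 / 2 * (p * (e.coord 4 X * e.coord 0 Y - e.coord 0 X * e.coord 4 Y)
        - q * (e.coord 0 X * e.coord 5 Y + e.coord 5 X * e.coord 0 Y)) ∧
    e.coord 3 ((h.su3Structure Γ).leviCivita x X Y) =
      1 / 2 * (p * (e.coord 4 X * e.coord 1 Y - e.coord 1 X * e.coord 4 Y)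
        - q * (e.coord 1 X * e.coord 5 Y + e.coord 5 X * e.coord 1 Y)) ∧
    e.coord 4 ((h.su3Structure Γ).leviCivita x X Y) =
      1 / 2 * (p * (e.coord 0 X * e.coord 2 Y + e.coord 2 X * e.coord 0 Y
        + e.coord 1 X * e.coord 3 Y + e.coord 3 X * e.coord 1 Y)) ∧
    e.coord 5 ((h.su3Structure Γ).leviCivita x X Y) =
      1 / 2 * (q * (e.coord 0 X * e.coord 2 Y - e.coord 2 X * e.coord 0 Y
        + e.coord 1 X * e.coord 3 Y - e.coord 3 X * e.coord 1 Y)) := by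
  obtain ⟨a0, a1, a2, a3, a4, a5⟩ := h.coord_bracket X Y
  refine ⟨?_, ?_, ?_, ?_, ?_, ?_⟩ <;> rw [coord_leviCivita] <;>
  [have b := h.coord_bracket X (e 0); have b := h.coord_bracket X (e 1);
   have b := h.coord_bracket X (e 2); have b := h.coord_bracket X (e 3);
   have b := h.coord_bracket X (e 4); have b := h.coord_bracket X (e 5)] <;>
  [have c := h.coord_bracket Y (e 0); have c := h.coord_bracket Y (e 1);
   have c := h.coord_bracket Y (e 2); have c := h.coord_bracket Y (e 3);
   have c := h.coord_bracket Y (e 4); have c := h.coord_bracket Y (e 5)] <;>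
  obtain ⟨b0, b1, b2, b3, b4, b5⟩ := b <;>
  obtain ⟨c0, c1, c2, c3, c4, c5⟩ := c <;>
  simp only [g_eq, a0, a1, a2, a3, a4, a5, b0, b1, b2, b3, b4, b5, c0, c1, c2, c3, c4, c5,
    coord_basis, Fin.reduceEq, if_true, if_false] <;> ring

theorem chern_eq (x : G) (X Y : Alg G) :
    e.coord 0 ((h.su3Structure Γ).chern x X Y) =
      1 / 2 * (p * (e.coord 5 X * e.coord 3 Y - e.coord 4 X * e.coord 2 Y)
        + q * (e.coord 2 X * e.coord 5 Y + e.coord 3 X * e.coord 4 Y)) ∧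
    e.coord 1 ((h.su3Structure Γ).chern x X Y) =
      1 / 2 * (-p * (e.coord 5 X * e.coord 2 Y + e.coord 4 X * e.coord 3 Y)
        + q * (e.coord 3 X * e.coord 5 Y - e.coord 2 X * e.coord 4 Y)) ∧
    e.coord 2 ((h.su3Structure Γ).chern x X Y) =
      1 / 2 * (p * (e.coord 5 X * e.coord 1 Y + e.coord 4 X * e.coord 0 Y)
        - q * (e.coord 0 X * e.coord 5 Y + e.coord 1 X * e.coord 4 Y)) ∧
    e.coord 3 ((h.su3Structure Γ).chern x X Y) =
      1 / 2 * (p * (e.coord 4 X * e.coord 1 Y - e.coord 5 X * e.coord 0 Y)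
        + q * (e.coord 0 X * e.coord 4 Y - e.coord 1 X * e.coord 5 Y)) ∧
    e.coord 4 ((h.su3Structure Γ).chern x X Y) =
      1 / 2 * (q * (e.coord 1 X * e.coord 2 Y - e.coord 0 X * e.coord 3 Y
        + e.coord 2 X * e.coord 1 Y - e.coord 3 X * e.coord 0 Y)) ∧
    e.coord 5 ((h.su3Structure Γ).chern x X Y) =
      1 / 2 * (q * (e.coord 0 X * e.coord 2 Y - e.coord 2 X * e.coord 0 Y
        + e.coord 1 X * e.coord 3 Y - e.coord 3 X * e.coord 1 Y)) := by
  obtain ⟨a0, a1, a2, a3, a4, a5⟩ := h.leviCivita_eq Γ x X Y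
  obtain ⟨b0, b1, b2, b3, b4, b5⟩ := h.coord_J X
  refine ⟨?_, ?_, ?_, ?_, ?_, ?_⟩ <;>
  simp only [coord_chern, dF_eq, a0, a1, a2, a3, a4, a5, b0, b1, b2, b3, b4,
    coord_basis, Fin.reduceEq, if_true, if_false] <;> ring

theorem bismut_eq (x : G) (X Y : Alg G) :
    e.coord 0 ((h.su3Structure Γ).bismut x X Y) =
      p / 2 * (e.coord 3 X * e.coord 5 Y - e.coord 2 X * e.coord 4 Y
        - e.coord 4 X * e.coord 2 Y - e.coord 5 X * e.coord 3 Y)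
        + q * (e.coord 5 X * e.coord 2 Y) ∧
    e.coord 1 ((h.su3Structure Γ).bismut x X Y) =
      p / 2 * (e.coord 5 X * e.coord 2 Y - e.coord 2 X * e.coord 5 Y
        - e.coord 3 X * e.coord 4 Y - e.coord 4 X * e.coord 3 Y)
        + q * (e.coord 5 X * e.coord 3 Y) ∧
    e.coord 2 ((h.su3Structure Γ).bismut x X Y) =
      p / 2 * (e.coord 1 X * e.coord 5 Y - e.coord 0 X * e.coord 4 Y
        + e.coord 4 X * e.coord 0 Y - e.coord 5 X * e.coord 1 Y)
        - q * (e.coord 5 X * e.coord 0 Y) ∧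
    e.coord 3 ((h.su3Structure Γ).bismut x X Y) =
      p / 2 * (e.coord 4 X * e.coord 1 Y + e.coord 5 X * e.coord 0 Y
        - e.coord 0 X * e.coord 5 Y - e.coord 1 X * e.coord 4 Y)
        - q * (e.coord 5 X * e.coord 1 Y) ∧
    e.coord 4 ((h.su3Structure Γ).bismut x X Y) =
      p / 2 * (e.coord 0 X * e.coord 2 Y + e.coord 1 X * e.coord 3 Y
        + e.coord 2 X * e.coord 0 Y + e.coord 3 X * e.coord 1 Y) ∧
    e.coord 5 ((h.su3Structure Γ).bismut x X Y) =
      p / 2 * (e.coord 0 X * e.coord 3 Y - e.coord 1 X * e.coord 2 Y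
        + e.coord 2 X * e.coord 1 Y - e.coord 3 X * e.coord 0 Y) := by
  obtain ⟨a0, a1, a2, a3, a4, a5⟩ := h.leviCivita_eq Γ x X Y
  refine ⟨?_, ?_, ?_, ?_, ?_, ?_⟩ <;>
  simp only [coord_bismut, T_eq, a0, a1, a2, a3, a4, a5,
    coord_basis, Fin.reduceEq, if_true, if_false] <;> ring

end IsAdaptedBasis

/-! ### The 4-forms `dT` and `p₁(∇^c)` -/

/-- The 2-form `eᵃ ∧ eᵇ` of a basis. -/
noncomputable def minor {L : Type*} [AddCommGroup L] [Module ℝ L] (e : Module.Basis (Fin 6) ℝ L)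
    (a b : Fin 6) (X Y : L) : ℝ := e.coord a X * e.coord b Y - e.coord b X * e.coord a Y

/-- The 4-form `eᵃ ∧ eᵇ ∧ eᶜ ∧ eᵈ` of a basis. -/
noncomputable def minor4 {L : Type*} [AddCommGroup L] [Module ℝ L] (e : Module.Basis (Fin 6) ℝ L)
    (a b c d : Fin 6) (X Y Z W : L) : ℝ :=
  minor e a b X Y * minor e c d Z W - minor e a b X Z * minor e c d Y W
    + minor e a b X W * minor e c d Y Z + minor e a b Y Z * minor e c d X W
    - minor e a b Y W * minor e c d X Z + minor e a b Z W * minor e c d X Y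

namespace IsAdaptedBasis

variable {J : Alg G →ₗ[ℝ] Alg G} {e : Module.Basis (Fin 6) ℝ (Alg G)} {p q : ℝ}
  (h : IsAdaptedBasis J e p q) (Γ : Subgroup G)

/-- There are no `pq` terms: `e⁰² + e¹³` is closed, and its wedge product with `e⁰³ - e¹²` is zero.
-/
theorem extDeriv3_T (x : G) (X Y Z W : Alg G) :
    extDeriv3 (h.su3Structure Γ).T x X Y Z W =
      -2 * q ^ 2 * minor4 e 0 1 2 3 X Y Z W - 2 * p ^ 2 * minor4 e 0 1 4 5 X Y Z W := by
  have k1 := h.coord_bracket X Y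
  have k2 := h.coord_bracket X Z
  have k3 := h.coord_bracket X W
  have k4 := h.coord_bracket Y Z
  have k5 := h.coord_bracket Y W
  have k6 := h.coord_bracket Z W
  simp only [extDeriv3, h.T_eq, der_const, k1, k2, k3, k4, k5, k6, minor4, minor]
  ring

theorem curvForm_chern (x : G) (i j : Fin 6) (X Y : Alg G) :
    (h.su3Structure Γ).curvForm (h.su3Structure Γ).chern x i j X Y =
      e.coord i (curvature (h.su3Structure Γ).chern x X Y (e j)) :=
  basisMetric_basis_right e _ i

theorem curvature_chern (x : G) (X Y Z : Alg G) :
    curvature (h.su3Structure Γ).chern x X Y Z =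
      (h.su3Structure Γ).chern x X ((h.su3Structure Γ).chern x Y Z)
        - (h.su3Structure Γ).chern x Y ((h.su3Structure Γ).chern x X Z)
        - (h.su3Structure Γ).chern x ⁅X, Y⁆ Z := by
  -- Constant coefficients: the derivative terms of the curvature drop out.
  have hD : (h.su3Structure Γ).chern = fun _ => (h.su3Structure Γ).chern x := by
    funext y U V
    apply e.ext_elem
    intro i
    have h1 := h.chern_eq Γ y U V
    have h2 := h.chern_eq Γ x U V
    simp only [Module.Basis.coord_apply] at h1 h2
    fin_cases i <;> simp [h1, h2]
  rw [hD, curvature_const]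

theorem curvForm_chern_eq (x : G) (X Y : Alg G) :
    let Ω := fun i j => (h.su3Structure Γ).curvForm (h.su3Structure Γ).chern x i j X Y
    let m := fun a b => minor e a b X Y
    Ω 0 1 = -(q ^ 2 / 2 * m 2 3) - p ^ 2 / 2 * m 4 5 ∧
    Ω 0 2 = -(q ^ 2 / 4 * (m 0 2 + m 1 3)) ∧
    Ω 0 3 = -(p * q / 2 * (m 0 2 + m 1 3)) + q ^ 2 / 4 * (m 0 3 - m 1 2) ∧
    Ω 0 4 = -(p * q / 4 * (m 0 5 - m 1 4)) ∧
    Ω 0 5 = p * q / 4 * (m 0 4 + m 1 5) ∧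
    Ω 1 2 = p * q / 2 * (m 0 2 + m 1 3) - q ^ 2 / 4 * (m 0 3 - m 1 2) ∧
    Ω 1 3 = -(q ^ 2 / 4 * (m 0 2 + m 1 3)) ∧
    Ω 1 4 = -(p * q / 4 * (m 0 4 + m 1 5)) ∧
    Ω 1 5 = -(p * q / 4 * (m 0 5 - m 1 4)) ∧
    Ω 2 3 = -(q ^ 2 / 2 * m 0 1) + p ^ 2 / 2 * m 4 5 ∧
    Ω 2 4 = p * q / 4 * (m 2 5 - m 3 4) ∧
    Ω 2 5 = -(p * q / 4 * (m 2 4 + m 3 5)) ∧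
    Ω 3 4 = p * q / 4 * (m 2 4 + m 3 5) ∧
    Ω 3 5 = p * q / 4 * (m 2 5 - m 3 4) ∧
    Ω 4 5 = q ^ 2 / 2 * (m 0 1 + m 2 3) := by
  have k := h.coord_bracket X Y
  refine ⟨?_, ?_, ?_, ?_, ?_, ?_, ?_, ?_, ?_, ?_, ?_, ?_, ?_, ?_, ?_⟩ <;>
  simp only [curvForm_chern, curvature_chern, map_sub, h.chern_eq, k, coord_basis, minor,
    Fin.reduceEq, if_true, if_false] <;> ring

/-- In the sum the `q⁴` terms cancel, and so do the `e²³⁴⁵` terms, leaving only the two 4-forms that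
occur in `dT`. -/
theorem p1_chern (x : G) (X Y Z W : Alg G) :
    (h.su3Structure Γ).p1 (h.su3Structure Γ).chern x X Y Z W = 1 / (8 * Real.pi ^ 2) *
      (-(p ^ 2 * q ^ 2) * (minor4 e 0 1 2 3 X Y Z W + minor4 e 0 1 4 5 X Y Z W)) := by
  rw [SU3Structure.p1]
  congr 1
  have k := h.curvForm_chern_eq Γ x
  simp only [Fin.sum_univ_six, Fin.reduceLT, if_true, if_false, wedgeSq, k, minor4]
  simp only [minor]
  ring

end IsAdaptedBasis

/-! ### The abelian connection -/

theorem complexForm_apply {L : Type*} [AddCommGroup L] [Module ℝ L]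
    (e : Module.Basis (Fin 6) ℝ L) (j k : Fin 6) (X : L) :
    complexForm e j k X = (e.coord j X : ℂ) + Complex.I * (e.coord k X : ℂ) := rfl

/-- The rotation of `⟨e₀, e₁⟩ ⊕ ⟨e₂, e₃⟩` that generates a maximal torus of an `SU(2)`. -/
noncomputable def torusGenerator {L : Type*} [AddCommGroup L] [Module ℝ L]
    (e : Module.Basis (Fin 6) ℝ L) : L →ₗ[ℝ] L :=
  (e.coord 1).smulRight (e 0) - (e.coord 0).smulRight (e 1)
    - (e.coord 3).smulRight (e 2) + (e.coord 2).smulRight (e 3)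

theorem coord_torusGenerator {L : Type*} [AddCommGroup L] [Module ℝ L]
    (e : Module.Basis (Fin 6) ℝ L) (X : L) :
    e.coord 0 (torusGenerator e X) = e.coord 1 X ∧
    e.coord 1 (torusGenerator e X) = -e.coord 0 X ∧
    e.coord 2 (torusGenerator e X) = -e.coord 3 X ∧
    e.coord 3 (torusGenerator e X) = e.coord 2 X ∧
    e.coord 4 (torusGenerator e X) = 0 ∧ e.coord 5 (torusGenerator e X) = 0 := by
  simp only [torusGenerator, LinearMap.add_apply, LinearMap.sub_apply,
    LinearMap.smulRight_apply, map_add, map_sub, map_smul, coord_basis]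
  simp

/-- The left-invariant abelian connection `2 e⁵ ⊗ M`, with `M` the generator of a torus. -/
noncomputable def torusConnection (e : Module.Basis (Fin 6) ℝ (Alg G)) :
    G → Alg G →ₗ[ℝ] Alg G →ₗ[ℝ] Alg G :=
  fun _ => (e.coord 5).smulRight ((2 : ℝ) • torusGenerator e)

theorem torusConnection_apply (e : Module.Basis (Fin 6) ℝ (Alg G)) (x : G)
    (X Y : Alg G) :
    torusConnection e x X Y = (2 * e.coord 5 X) • torusGenerator e Y := by
  simp [torusConnection, smul_smul, mul_comm]

/-- All connection matrices are multiples of one endomorphism, so commutators vanish and only `2 de⁵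
⊗ M` remains. -/
theorem curvature_torusConnection (e : Module.Basis (Fin 6) ℝ (Alg G)) (x : G)
    (X Y Z : Alg G) :
    curvature (SU3Structure.toConn (torusConnection e)) x X Y Z =
      (-2 * e.coord 5 ⁅X, Y⁆) • torusGenerator e Z := by
  have hD : SU3Structure.toConn (torusConnection e) =
      fun (_ : G) X Y => (2 * e.coord 5 X) • torusGenerator e Y := by
    funext y U V; exact torusConnection_apply e y U V
  rw [hD, curvature_const]
  simp only [map_smul]
  module

/-! ### Holomorphic volume form, Lee form and instanton -/

namespace IsAdaptedBasis

variable {J : Alg G →ₗ[ℝ] Alg G} {e : Module.Basis (Fin 6) ℝ (Alg G)} {p q : ℝ}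
  (h : IsAdaptedBasis J e p q) (Γ : Subgroup G)

theorem Ψ_eq (x : G) (X Y Z : Alg G) : (h.su3Structure Γ).Ψ x X Y Z =
    complexForm e 0 1 X * (complexForm e 2 3 Y * complexForm e 4 5 Z
      - complexForm e 2 3 Z * complexForm e 4 5 Y)
    - complexForm e 0 1 Y * (complexForm e 2 3 X * complexForm e 4 5 Z
      - complexForm e 2 3 Z * complexForm e 4 5 X)
    + complexForm e 0 1 Z * (complexForm e 2 3 X * complexForm e 4 5 Y
      - complexForm e 2 3 Y * complexForm e 4 5 X) := by
  change Matrix.det !![complexForm e 0 1 X, complexForm e 0 1 Y, complexForm e 0 1 Z;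
                  complexForm e 2 3 X, complexForm e 2 3 Y, complexForm e 2 3 Z;
                  complexForm e 4 5 X, complexForm e 4 5 Y, complexForm e 4 5 Z] = _
  rw [Matrix.det_fin_three]
  simp
  ring

include h in
theorem complexForm_bracket (X Y : Alg G) :
    complexForm e 0 1 ⁅X, Y⁆ = 0 ∧
    complexForm e 2 3 ⁅X, Y⁆ = p * (e.coord 4 X * complexForm e 0 1 Y
      - e.coord 4 Y * complexForm e 0 1 X) ∧
    complexForm e 4 5 ⁅X, Y⁆ = Complex.I * q / 2 *
      (complexForm e 0 1 X * (starRingEnd ℂ) (complexForm e 2 3 Y)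
        + (starRingEnd ℂ) (complexForm e 0 1 X) * complexForm e 2 3 Y
        - complexForm e 0 1 Y * (starRingEnd ℂ) (complexForm e 2 3 X)
        - (starRingEnd ℂ) (complexForm e 0 1 Y) * complexForm e 2 3 X) := by
  have k := h.coord_bracket X Y
  simp only [complexForm_apply, k, map_add, map_mul, Complex.conj_I, Complex.conj_ofReal]
  push_cast
  refine ⟨by ring, by ring, ?_⟩
  ring_nf
  simp only [Complex.I_pow_three]
  ring

/-- Write `Ψ = ζ₁ ∧ ζ₂ ∧ ζ₃`. Here `dζ₁ = 0`, `dζ₂` is divisible by `ζ₁`, and each term of `dζ₃`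
contains `ζ₁` or `ζ₂`. -/
theorem extDeriv3_Ψ (x : G) (X Y Z W : Alg G) :
    extDeriv3 (h.su3Structure Γ).Ψ x X Y Z W = 0 := by
  have k1 := h.complexForm_bracket X Y
  have k2 := h.complexForm_bracket X Z
  have k3 := h.complexForm_bracket X W
  have k4 := h.complexForm_bracket Y Z
  have k5 := h.complexForm_bracket Y W
  have k6 := h.complexForm_bracket Z W
  simp only [extDeriv3, h.Ψ_eq, der_const, k1, k2, k3, k4, k5, k6]
  ring

/-- The metric is balanced: no monomial of `dF` contains one of the `J`-pairs 01, 23, 45, so the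
contraction of `dF` with `F` is zero. -/
theorem lee_eq_zero (x : G) (X : Alg G) : (h.su3Structure Γ).lee x X = 0 := by
  have hf : (h.su3Structure Γ).frame x = e := rfl
  simp only [SU3Structure.lee, SU3Structure.codiffF, SU3Structure.nablaF, hf, h.F_eq, der_const,
    h.leviCivita_eq, Fin.sum_univ_six, coord_basis, Fin.reduceEq, if_true, if_false]
  ring

theorem isSU3Connection_torusConnection :
    (h.su3Structure Γ).IsSU3Connection (torusConnection e) where
  smooth X Y := isSmoothOnQuotient_const (V := E6) Γ _
  metric x X Y Z := by
    have k1 := coord_torusGenerator e Y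
    have k2 := coord_torusGenerator e Z
    simp only [h.g_eq, der_const, torusConnection_apply]
    simp only [map_smul, smul_eq_mul, k1, k2]
    ring
  complex x X Y := by
    have k := coord_torusGenerator e Y
    have k2 := coord_torusGenerator e (J Y)
    have k1 := h.coord_J Y
    have k3 := h.coord_J (torusGenerator e Y)
    simp only [torusConnection_apply, map_smul]
    congr 1
    apply e.ext_elem
    intro i
    simp only [k1] at k2
    simp only [k] at k3
    simp only [Module.Basis.coord_apply] at k2 k3
    fin_cases i <;> simp [k2, k3]
  volume x X Y Z W := by
    have key : ∀ V, complexForm e 0 1 (torusConnection e x X V) =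
          -(2 * Complex.I * e.coord 5 X * complexForm e 0 1 V) ∧
        complexForm e 2 3 (torusConnection e x X V) =
          2 * Complex.I * e.coord 5 X * complexForm e 2 3 V ∧
        complexForm e 4 5 (torusConnection e x X V) = 0 := by
      intro V
      have k := coord_torusGenerator e V
      simp only [complexForm_apply, torusConnection_apply, map_smul, k, smul_eq_mul]
      push_cast
      refine ⟨?_, ?_, by ring⟩
      · linear_combination (2 * (e.coord 5 X : ℂ) * e.coord 1 V) * Complex.I_sq
      · linear_combination -(2 * (e.coord 5 X : ℂ) * e.coord 3 V) * Complex.I_sq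
    simp only [h.Ψ_eq, der_const, key]
    ring

theorem curvForm_torusConnection (x : G) (i j : Fin 6) (X Y : Alg G) :
    (h.su3Structure Γ).curvForm (SU3Structure.toConn (torusConnection e)) x i j X Y =
      -2 * q * (minor e 0 2 X Y + minor e 1 3 X Y) * e.coord i (torusGenerator e (e j)) := by
  have k := h.coord_bracket X Y
  have hb : (h.su3Structure Γ).curvForm (SU3Structure.toConn (torusConnection e)) x i j X Y =
      e.coord i (curvature (SU3Structure.toConn (torusConnection e)) x X Y (e j)) :=
    basisMetric_basis_right e _ i
  rw [hb, curvature_torusConnection, map_smul, smul_eq_mul, k.2.2.2.2.2]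
  simp only [minor]
  ring

theorem isInstanton_torusConnection :
    (h.su3Structure Γ).IsInstanton (torusConnection e) where
  su3 := h.isSU3Connection_torusConnection Γ
  type11 x i j X Y := by
    have k1 := h.coord_J X
    have k2 := h.coord_J Y
    simp only [h.curvForm_torusConnection, minor, k1, k2]
    ring
  primitive x i j := by
    have hf : (h.su3Structure Γ).frame x = e := rfl
    simp only [h.curvForm_torusConnection, minor, hf, coord_basis, Fin.reduceEq, if_true,
      if_false]
    ring

/-- Only the entries 01 and 23 contribute, each `4q² (e⁰² + e¹³)² = -8q² e⁰¹²³`. -/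
theorem p1_torusConnection (x : G) (X Y Z W : Alg G) :
    (h.su3Structure Γ).p1 (SU3Structure.toConn (torusConnection e)) x X Y Z W =
      1 / (8 * Real.pi ^ 2) * (-(16 * q ^ 2) * minor4 e 0 1 2 3 X Y Z W) := by
  rw [SU3Structure.p1]
  congr 1
  have k := fun j => coord_torusGenerator e (e j)
  simp only [Fin.sum_univ_six, Fin.reduceLT, if_true, if_false, wedgeSq,
    h.curvForm_torusConnection, k, coord_basis, Fin.reduceEq, minor4, minor]
  ring

/-! ### Holonomy of the Bismut connection -/

/-- The complex 1-forms transform under the Bismut connection by a skew-Hermitian matrix of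
trace zero. -/
theorem complexForm_bismut (x : G) (X : Alg G) : ∃ a b c a' b' c' : ℂ, ∀ Y,
    complexForm e 0 1 ((h.su3Structure Γ).bismut x X Y) =
      a * complexForm e 2 3 Y + b * complexForm e 4 5 Y ∧
    complexForm e 2 3 ((h.su3Structure Γ).bismut x X Y) =
      a' * complexForm e 0 1 Y + c * complexForm e 4 5 Y ∧
    complexForm e 4 5 ((h.su3Structure Γ).bismut x X Y) =
      b' * complexForm e 0 1 Y + c' * complexForm e 2 3 Y := by
  refine ⟨-p / 2 * e.coord 4 X + q * e.coord 5 X + Complex.I * (p / 2 * e.coord 5 X),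
    -(p / 2) * complexForm e 2 3 X, -(p / 2) * complexForm e 0 1 X,
    p / 2 * e.coord 4 X - q * e.coord 5 X + Complex.I * (p / 2 * e.coord 5 X),
    p / 2 * (starRingEnd ℂ) (complexForm e 2 3 X),
    p / 2 * (starRingEnd ℂ) (complexForm e 0 1 X), fun Y => ?_⟩
  have k := h.bismut_eq Γ x X Y
  simp only [complexForm_apply, k, map_add, map_mul, Complex.conj_I, Complex.conj_ofReal]
  push_cast
  refine ⟨?_, ?_, ?_⟩ <;>
  · ring_nf
    simp only [Complex.I_sq]
    ring

theorem g_bismut (x : G) (X Y Z : Alg G) :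
    (h.su3Structure Γ).g x ((h.su3Structure Γ).bismut x X Y) Z
      + (h.su3Structure Γ).g x Y ((h.su3Structure Γ).bismut x X Z) = 0 := by
  have k1 := h.bismut_eq Γ x X Y
  have k2 := h.bismut_eq Γ x X Z
  simp only [h.g_eq, k1, k2]
  ring

theorem F_bismut (x : G) (X Y Z : Alg G) :
    (h.su3Structure Γ).F x ((h.su3Structure Γ).bismut x X Y) Z
      + (h.su3Structure Γ).F x Y ((h.su3Structure Γ).bismut x X Z) = 0 := by
  have k1 := h.bismut_eq Γ x X Y
  have k2 := h.bismut_eq Γ x X Z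
  simp only [h.F_eq, k1, k2]
  ring

/-- An endomorphism acts on `ζ₁ ∧ ζ₂ ∧ ζ₃` through its trace, and the matrix in `complexForm_bismut`
has zero diagonal. -/
theorem Ψ_bismut (x : G) (X Y Z W : Alg G) :
    (h.su3Structure Γ).Ψ x ((h.su3Structure Γ).bismut x X Y) Z W
      + (h.su3Structure Γ).Ψ x Y ((h.su3Structure Γ).bismut x X Z) W
      + (h.su3Structure Γ).Ψ x Y Z ((h.su3Structure Γ).bismut x X W) = 0 := by
  obtain ⟨a, b, c, a', b', c', k⟩ := h.complexForm_bismut Γ x X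
  simp only [h.Ψ_eq, k]
  ring

end IsAdaptedBasis

theorem eq_of_hasDerivWithinAt_zero {V : Type*} [NormedAddCommGroup V] [NormedSpace ℝ V]
    {f : ℝ → V} (hf : ∀ t ∈ Set.Icc (0 : ℝ) 1, HasDerivWithinAt f 0 (Set.Icc (0 : ℝ) 1) t) :
    f 1 = f 0 := by
  refine constant_of_derivWithin_zero (fun t ht => (hf t ht).differentiableWithinAt)
    (fun t ht => ?_) 1 (Set.right_mem_Icc.mpr zero_le_one)
  exact (hf t (Set.Ico_subset_Icc_self ht)).derivWithin
    (uniqueDiffOn_Icc zero_lt_one t (Set.Ico_subset_Icc_self ht))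

theorem hasDerivWithinAt_linear (l : Alg G →ₗ[ℝ] ℝ) {f : ℝ → Alg G} {f' : Alg G} {s : Set ℝ}
    {t : ℝ} (hf : HasDerivWithinAt (F := E6) f f' s t) :
    HasDerivWithinAt (fun u => l (f u)) (l f') s t := by
  -- Reading `l` on the model space `E6` supplies the norm and finite dimension needed for
  -- continuity.
  let l' : E6 →ₗ[ℝ] ℝ := l
  exact (LinearMap.toContinuousLinearMap l').hasFDerivAt.comp_hasDerivWithinAt t hf

theorem hasDerivWithinAt_complexForm (e : Module.Basis (Fin 6) ℝ (Alg G)) (j k : Fin 6)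
    {f : ℝ → Alg G} {f' : Alg G} {s : Set ℝ} {t : ℝ}
    (hf : HasDerivWithinAt (F := E6) f f' s t) :
    HasDerivWithinAt (fun u => complexForm e j k (f u)) (complexForm e j k f') s t :=
  (hasDerivWithinAt_linear (e.coord j) hf).ofReal_comp.add
    ((hasDerivWithinAt_linear (e.coord k) hf).ofReal_comp.const_mul Complex.I)

theorem complexForm_neg {L : Type*} [AddCommGroup L] [Module ℝ L]
    (e : Module.Basis (Fin 6) ℝ L) (j k : Fin 6) (X : L) :
    complexForm e j k (-X) = -complexForm e j k X := by
  simp only [complexForm_apply, map_neg]; push_cast; ring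

namespace IsAdaptedBasis

variable {J : Alg G →ₗ[ℝ] Alg G} {e : Module.Basis (Fin 6) ℝ (Alg G)} {p q : ℝ}
  (h : IsAdaptedBasis J e p q) (Γ : Subgroup G)

/-- `g`, `F` and `Ψ` have constant coefficients, so along parallel fields the derivatives of their
values are given by `g_bismut`, `F_bismut` and `Ψ_bismut`, hence vanish; compare times 0 and 1. -/
theorem mem_su3Group_of_isHolonomy (x : G) (L : Alg G →ₗ[ℝ] Alg G)
    (hL : IsHolonomy Γ (h.su3Structure Γ).bismut x L) : L ∈ (h.su3Structure Γ).su3Group x := by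
  obtain ⟨c, ξ, P, -, -, -, -, hP⟩ := hL
  have hP0 : ∀ v, P 0 v = v := fun v => (hP v).1
  have hP1 : ∀ v, P 1 v = L v := fun v => (hP v).2.1
  have hd : ∀ v (i : Fin 6), ∀ t ∈ Set.Icc (0 : ℝ) 1, HasDerivWithinAt
      (fun s => e.coord i (P s v))
      (-e.coord i ((h.su3Structure Γ).bismut (c t) (ξ t) (P t v))) (Set.Icc (0 : ℝ) 1) t := by
    intro v i t ht
    rw [← map_neg]
    exact hasDerivWithinAt_linear (e.coord i) ((hP v).2.2 t ht)
  have hζ : ∀ v (i j : Fin 6), ∀ t ∈ Set.Icc (0 : ℝ) 1, HasDerivWithinAt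
      (fun s => complexForm e i j (P s v))
      (-complexForm e i j ((h.su3Structure Γ).bismut (c t) (ξ t) (P t v)))
      (Set.Icc (0 : ℝ) 1) t := by
    intro v i j t ht
    rw [← complexForm_neg]
    exact hasDerivWithinAt_complexForm e i j ((hP v).2.2 t ht)
  have hg : ∀ v w, (h.su3Structure Γ).g x (L v) (L w) = (h.su3Structure Γ).g x v w := by
    intro v w
    rw [← hP1 v, ← hP1 w]
    conv_rhs => rw [← hP0 v, ← hP0 w]
    refine eq_of_hasDerivWithinAt_zero
      (f := fun t => (h.su3Structure Γ).g x (P t v) (P t w)) fun t ht => ?_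
    simp only [h.g_eq]
    have d := fun i => (hd v i t ht).mul (hd w i t ht)
    refine ((((((d 0).add (d 1)).add (d 2)).add (d 3)).add (d 4)).add (d 5)).congr_deriv ?_
    have k := h.g_bismut Γ (c t) (ξ t) (P t v) (P t w)
    simp only [h.g_eq] at k
    linear_combination -k
  have hF : ∀ v w, (h.su3Structure Γ).F x (L v) (L w) = (h.su3Structure Γ).F x v w := by
    intro v w
    rw [← hP1 v, ← hP1 w]
    conv_rhs => rw [← hP0 v, ← hP0 w]
    refine eq_of_hasDerivWithinAt_zero
      (f := fun t => (h.su3Structure Γ).F x (P t v) (P t w)) fun t ht => ?_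
    simp only [h.F_eq]
    have d := fun i j => ((hd v i t ht).mul (hd w j t ht)).sub ((hd v j t ht).mul (hd w i t ht))
    refine (((d 0 1).add (d 2 3)).add (d 4 5)).congr_deriv ?_
    have k := h.F_bismut Γ (c t) (ξ t) (P t v) (P t w)
    simp only [h.F_eq] at k
    linear_combination -k
  refine ⟨hg, fun X => ?_, fun u v w => ?_⟩
  -- Commutation with `J` follows from `g` and `F`: the square norm of `L (J X) - J (L X)` expands
  -- to zero.
  · by_contra hne
    have hpos := (h.su3Structure Γ).g_pos x _ (sub_ne_zero.mpr hne)
    have h1 := hg (J X) (J X)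
    have h2 := hg X X
    have h3 := hF (J X) X
    have h4 := (h.su3Structure Γ).g_hermitian x (L X) (L X)
    have h5 := (h.su3Structure Γ).g_hermitian x X X
    have h6 := (h.su3Structure Γ).g_symm x (J (L X)) (L (J X))
    simp only [SU3Structure.F] at h3
    simp only [map_sub, LinearMap.sub_apply] at hpos
    linarith
  · rw [← hP1 u, ← hP1 v, ← hP1 w]
    conv_rhs => rw [← hP0 u, ← hP0 v, ← hP0 w]
    refine eq_of_hasDerivWithinAt_zero
      (f := fun t => (h.su3Structure Γ).Ψ x (P t u) (P t v) (P t w)) fun t ht => ?_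
    simp only [h.Ψ_eq]
    have d := fun a b b' => (hζ a 0 1 t ht).mul (((hζ b 2 3 t ht).mul (hζ b' 4 5 t ht)).sub
      ((hζ b' 2 3 t ht).mul (hζ b 4 5 t ht)))
    refine (((d u v w).sub (d v u w)).add (d w u v)).congr_deriv ?_
    have k := h.Ψ_bismut Γ (c t) (ξ t) (P t u) (P t v) (P t w)
    simp only [h.Ψ_eq] at k
    simp only [Pi.sub_apply, Pi.mul_apply]
    linear_combination -k

/-! ### The heterotic system for `p = 5`, `q² = 9` -/

theorem solvesHeterotic (h : IsAdaptedBasis J e 5 q) (hq : q ^ 2 = 9) :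
    (h.su3Structure Γ).SolvesHeterotic (fun _ => 0) (torusConnection e) (8 / 9) where
  holomorphic := h.extDeriv3_Ψ Γ
  gravitino := h.mem_su3Group_of_isHolonomy Γ
  dilaton_smooth := isSmoothOnQuotient_const Γ 0
  dilatino x X := by rw [h.lee_eq_zero, der_const, mul_zero]
  gaugino := h.isInstanton_torusConnection Γ
  alpha_pos := by norm_num
  anomaly x X Y Z W := by
    rw [h.extDeriv3_T, h.p1_chern, h.p1_torusConnection, hq]
    field_simp
    ring

theorem T_ne_zero (hq : q ≠ 0) (x : G) : (h.su3Structure Γ).T x (e 0) (e 2) (e 5) ≠ 0 := by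
  simpa [h.T_eq, Finsupp.single_apply] using hq

include h in
theorem curvature_torusConnection_ne_zero (hq : q ≠ 0) (x : G) :
    curvature (SU3Structure.toConn (torusConnection e)) x (e 1) (e 3) (e 1) ≠ 0 := by
  intro h0
  have k := congrArg (e.coord 0) h0
  rw [curvature_torusConnection, map_smul, (coord_torusGenerator e _).1,
    (h.coord_bracket _ _).2.2.2.2.2] at k
  simp [hq] at k

end IsAdaptedBasis

end Heterotic

theorem corollary4p5
    {G : Type*} [Group G] [TopologicalSpace G] [ChartedSpace Heterotic.E6 G]
    [LieGroup (𝓡 6) ∞ G] [SimplyConnectedSpace G]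
    (hG : Heterotic.IsAlgebraN (Heterotic.Alg G))
    (Γ : Subgroup G) [DiscreteTopology Γ]
    [CompactSpace (Quotient (QuotientGroup.rightRel Γ))]
    (J : Heterotic.Alg G →ₗ[ℝ] Heterotic.Alg G) (hJ : Heterotic.IsComplexStructure J) :
    ∃ (S : Heterotic.SU3Structure Γ J) (φ : G → ℝ)
      (A : G → Heterotic.Alg G →ₗ[ℝ] Heterotic.Alg G →ₗ[ℝ] Heterotic.Alg G) (α' : ℝ),
      S.SolvesHeterotic φ A α' ∧
      (∃ x X Y Z, S.T x X Y Z ≠ 0) ∧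
      (∃ c : ℝ, ∀ x, φ x = c) ∧
      (∃ x X Y Z, Heterotic.curvature (Heterotic.SU3Structure.toConn A) x X Y Z ≠ 0) := by
  obtain ⟨e, q, hq, h⟩ := hJ.exists_adaptedBasis hG
  have hq0 : q ≠ 0 := by rintro rfl; norm_num at hq
  exact ⟨h.su3Structure Γ, fun _ => 0, Heterotic.torusConnection e, 8 / 9,
    h.solvesHeterotic Γ hq, ⟨1, _, _, _, h.T_ne_zero Γ hq0 1⟩, ⟨0, fun _ => rfl⟩,
    ⟨1, _, _, _, h.curvature_torusConnection_ne_zero hq0 1⟩⟩
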